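/- **Setting.** Let $\mathcal X$ be a set of datasets with a neighbouring relation $\sim$ (for instance: adding or removing the data of one user). Let $U$ be a (possibly infinite) set of elements, and let every dataset $x$ have a histogram $h^x : U \to \mathbb N$ with at most $\bar d$ nonzero counts. Assume that for neighbours $x \sim x'$ the histograms $h^x, h^{x'}$ differ in at most $\Delta$ elements, and that $|h^x_a - h^{x'}_a| \le \tau$ for every element $a$, where $\Delta\in\mathbb N$ and $\tau > 0$. Let $\sigma > 0$, and let $\Phi$, $\phi$ be the standard normal distribution function and density. Let $\delta < \Delta$ (which holds for every $\delta \in (0,1)$ when $\Delta \ge 1$), and let $T > 0$ solve $$\delta = \Delta \left( 1 - \frac{\Phi\left( \frac{T}{\tau\sigma} \right) - \Phi\left( \frac{\tau-T}{\tau\sigma} \right)}{\Phi\left( \frac{T}{\tau\sigma} \right) - \Phi\left( \frac{-T}{\tau\sigma} \right)} \right).$$ **Truncated Gaussian.** $\mathrm{TruncNormal}_T(\mu, s^2)$ is the law on $\mathbb R$ with density $\frac1s\,\phi\left(\frac{z-\mu}{s}\right) / \left(\Phi\left(\frac{T}{s}\right) - \Phi\left(\frac{-T}{s}\right)\right)$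 for $\mu - T \le z \le \mu + T$, and density $0$ otherwise. **Mechanism $\mathrm{TruncGauss}^{\Delta,\bar d,\tau}$.** On a histogram $h$ it sorts the counts, $h_{(1)} \ge h_{(2)} \ge \dots \ge h_{(\bar d)}$ (padded with zeros that carry no element), where $a_{(i)}$ is the element with the $i$-th largest count; it draws $v_i \sim \mathrm{TruncNormal}_T(h_{(i)}, \tau^2\sigma^2)$ independently for $i \le \bar d$, and it returns the set $S = \{(a_{(i)}, v_i) : v_i > \tau + T\}$ of elements with their noisy counts. (A zero count gives $v_i \le T$, so it is never returned.) **Privacy notion.** For $\alpha > 1$ let $D_\alpha(P\|Q) = \frac{1}{\alpha-1} \log \mathbb E_{z\sim P}\left[ \left(\frac{dP}{dQ}(z)\right)^{\alpha-1}\right]$ if $P \ll Q$, and $D_\alpha(P\|Q) = \infty$ otherwise. A randomized algorithm $M$ on $\mathcal X$ is $\delta$-approximately $(\xi,\rho)$-zCDP if for all neighbours $x \sim x'$ there are events $E$, $E'$ of positive probability over the randomness of $M(x)$ and of $M(x')$ respectively, with $\Pr[E], \Pr[E'] \ge 1-\delta$, such that for every $\alpha > 1$ $$D_\alpha(M(x)|_E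 \,\|\, M(x')|_{E'}) \le \alpha\rho + \xi \quad\text{and}\quad D_\alpha(M(x')|_{E'} \,\|\, M(x)|_{E}) \le \alpha\rho + \xi,$$ where $M(x)|_E$ is the distribution of the output $M(x)$ conditioned on $E$. **Lemma.** The algorithm $x \mapsto \mathrm{TruncGauss}^{\Delta,\bar d,\tau}(h^x)$ is $\delta$-approximately $\left(0, \frac{\Delta}{2\sigma^2}\right)$-zCDP. -/

import Mathlib

open MeasureTheory ProbabilityTheory
open scoped ENNReal

noncomputable section

/-! ### Rényi divergence and approximate zero-mean concentrated differential privacy -/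

/-- The Rényi divergence of order `α > 1`,
`D_α(P ‖ Q) = (α - 1)⁻¹ * log E_{z ∼ P} [(P(z) / Q(z)) ^ (α - 1)]`, as an extended real;
`P(z) / Q(z)` is the Radon-Nikodym derivative, and the divergence is `⊤` when `P` is not absolutely
continuous with respect to `Q`. -/
def renyiDiv {Y : Type*} [MeasurableSpace Y] (α : ℝ) (P Q : Measure Y) : EReal :=
  open Classical in
  if P ≪ Q then
    (((α - 1)⁻¹ : ℝ) : EReal) * ENNReal.log (∫⁻ z, (P.rnDeriv Q z) ^ (α - 1) ∂P)
  else ⊤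

/-- A randomized algorithm with inputs in `X` and outputs in `Y`: on input `x` it draws its
randomness `ω : Ω` from the probability measure `prob x`, and it returns `out x ω`. -/
structure RandomizedAlgorithm (X Ω Y : Type*) [MeasurableSpace Ω] [MeasurableSpace Y] where
  prob : X → Measure Ω
  isProbabilityMeasure_prob : ∀ x, IsProbabilityMeasure (prob x)
  out : X → Ω → Y
  measurable_out : ∀ x, Measurable (out x)

namespace RandomizedAlgorithm

variable {X Ω Y : Type*} [MeasurableSpace Ω] [MeasurableSpace Y]

/-- `M(x)|_E`: the distribution of the output `M(x)` conditioned on the event `E`. -/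
def condLaw (M : RandomizedAlgorithm X Ω Y) (x : X) (E : Set Ω) : Measure Y :=
  ((M.prob x)[|E]).map (M.out x)

/-- `M` run on the statistic `f(x)` of the dataset `x`. -/
def comp (M : RandomizedAlgorithm X Ω Y) {X' : Type*} (f : X' → X) :
    RandomizedAlgorithm X' Ω Y where
  prob x := M.prob (f x)
  isProbabilityMeasure_prob x := M.isProbabilityMeasure_prob (f x)
  out x := M.out (f x)
  measurable_out x := M.measurable_out (f x)

/-- `M` is `δ`-approximately `(ξ, ρ)`-zCDP with respect to the neighbouring relation `nbr`: for
neighbours `x, x'` there are events `E` (for the run on `x`) and `E'` (for the run on `x'`), of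
probability at least `1 - δ` each, such that the outputs conditioned on these events have Rényi
divergence at most `α * ρ + ξ` in both directions, for every order `α > 1`.
(The events have positive probability, so that the conditional distributions exist; this is
automatic for `δ < 1`.) -/
def IsApproxZCDP (M : RandomizedAlgorithm X Ω Y) (nbr : X → X → Prop) (δ ξ ρ : ℝ) : Prop :=
  ∀ x x' : X, nbr x x' → ∃ E E' : Set Ω,
    MeasurableSet E ∧ MeasurableSet E' ∧
    M.prob x E ≠ 0 ∧ M.prob x' E' ≠ 0 ∧
    ENNReal.ofReal (1 - δ) ≤ M.prob x E ∧ ENNReal.ofReal (1 - δ) ≤ M.prob x' E' ∧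
    ∀ α : ℝ, 1 < α →
      renyiDiv α (M.condLaw x E) (M.condLaw x' E') ≤ ((α * ρ + ξ : ℝ) : EReal) ∧
      renyiDiv α (M.condLaw x' E') (M.condLaw x E) ≤ ((α * ρ + ξ : ℝ) : EReal)

end RandomizedAlgorithm

/-! ### The symmetric truncated Gaussian -/

/-- The standard normal density `φ`. -/
def stdNormalPDF (z : ℝ) : ℝ := gaussianPDFReal 0 1 z

/-- The standard normal distribution function `Φ`. -/
def stdNormalCDF (z : ℝ) : ℝ := cdf (gaussianReal 0 1) z

/-- The density of the Gaussian with mean `μ` and standard deviation `s`, truncated to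
`[μ - T, μ + T]`. -/
def truncNormalPDF (T μ s z : ℝ) : ℝ :=
  open Classical in
  if μ - T ≤ z ∧ z ≤ μ + T then
    1 / s * (stdNormalPDF ((z - μ) / s) / (stdNormalCDF (T / s) - stdNormalCDF (-T / s)))
  else 0

/-- The truncated Gaussian with truncation value `T`, mean `μ` and standard deviation `s`. -/
def truncNormal (T μ s : ℝ) : Measure ℝ :=
  volume.withDensity fun z => ENNReal.ofReal (truncNormalPDF T μ s z)

theorem stdNormalCDF_sub {a b : ℝ} (hab : a ≤ b) :
    gaussianReal 0 1 (Set.Icc a b) = ENNReal.ofReal (stdNormalCDF b - stdNormalCDF a) := by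
  have : NullSingletonClass (gaussianReal 0 1) := nullSingletonClass_gaussianReal (by simp)
  rw [← measure_congr (Ioc_ae_eq_Icc (a := a) (b := b))]
  conv_lhs => rw [← measure_cdf (gaussianReal 0 1)]
  rw [StieltjesFunction.measure_Ioc]
  rfl

theorem stdNormalCDF_lt {a b : ℝ} (hab : a < b) : stdNormalCDF a < stdNormalCDF b := by
  have h1 : 0 < gaussianReal 0 1 (Set.Icc a b) := by
    rw [pos_iff_ne_zero]
    intro h0
    have h2 := gaussianReal_absolutelyContinuous' 0 (v := 1) (by simp) h0
    rw [Real.volume_Icc] at h2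
    simp at h2
    linarith
  rw [stdNormalCDF_sub hab.le] at h1
  have := ENNReal.ofReal_pos.mp h1
  linarith

theorem isProbabilityMeasure_truncNormal {T s : ℝ} (hT : 0 < T) (hs : 0 < s) (μ : ℝ) :
    IsProbabilityMeasure (truncNormal T μ s) := by
  constructor
  have hlt : -T / s < T / s := by
    rw [div_lt_div_iff_of_pos_right hs]; linarith
  set c := stdNormalCDF (T / s) - stdNormalCDF (-T / s) with hc
  have hcpos : 0 < c := sub_pos.mpr (stdNormalCDF_lt hlt)
  have hpdf : ∀ z, ENNReal.ofReal (truncNormalPDF T μ s z) =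
      (ENNReal.ofReal c⁻¹) * (Set.Icc (μ - T) (μ + T)).indicator
        (gaussianPDF μ (.mk (s ^ 2) (sq_nonneg _))) z := by
    intro z
    unfold truncNormalPDF
    by_cases hz : μ - T ≤ z ∧ z ≤ μ + T
    · rw [if_pos hz, Set.indicator_of_mem (show z ∈ Set.Icc _ _ from hz), gaussianPDF,
        ← ENNReal.ofReal_mul (by positivity)]
      congr 1
      have hs0 : s ≠ 0 := hs.ne'
      simp only [stdNormalPDF, gaussianPDFReal]
      have hsq : Real.sqrt (2 * Real.pi * s ^ 2) = Real.sqrt (2 * Real.pi) * s := by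
        rw [Real.sqrt_mul (by positivity), Real.sqrt_sq hs.le]
      simp only [NNReal.coe_mk, NNReal.coe_one, hsq, mul_one, ← hc]
      have he : -((z - μ) / s - 0) ^ 2 / 2 = -(z - μ) ^ 2 / (2 * s ^ 2) := by
        field_simp
        ring
      rw [he]
      field_simp
    · rw [if_neg hz, Set.indicator_of_notMem (show z ∉ Set.Icc _ _ from hz)]
      simp
  have hmap : gaussianReal μ (.mk (s ^ 2) (sq_nonneg _)) (Set.Icc (μ - T) (μ + T))
      = gaussianReal 0 1 (Set.Icc (-T / s) (T / s)) := by
    have h1 : gaussianReal μ (.mk (s ^ 2) (sq_nonneg _)) =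
        (gaussianReal 0 1).map (fun z => s * z + μ) := by
      have := gaussianReal_map_const_mul (μ := 0) (v := 1) s
      rw [show (fun z : ℝ => s * z + μ) = (fun z => z + μ) ∘ (fun z => s * z) from rfl,
        ← Measure.map_map (by fun_prop) (by fun_prop), this, gaussianReal_map_add_const]
      simp
    rw [h1, Measure.map_apply (by fun_prop) measurableSet_Icc]
    congr 1
    ext z
    simp only [Set.mem_preimage, Set.mem_Icc, div_le_iff₀ hs, le_div_iff₀ hs]
    constructor <;> rintro ⟨h, h'⟩ <;> constructor <;> nlinarith
  have hs2 : (NNReal.mk (s ^ 2) (sq_nonneg _)) ≠ 0 := by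
    intro h
    have := congrArg NNReal.toReal h
    simp at this
    exact hs.ne' this
  rw [truncNormal, withDensity_apply _ MeasurableSet.univ, Measure.restrict_univ]
  simp_rw [hpdf]
  rw [lintegral_const_mul _ ((measurable_gaussianPDF _ _).indicator measurableSet_Icc),
    lintegral_indicator measurableSet_Icc, ← gaussianReal_apply _ hs2, hmap,
    stdNormalCDF_sub hlt.le, ← hc, ← ENNReal.ofReal_mul (by positivity),
    inv_mul_cancel₀ hcpos.ne', ENNReal.ofReal_one]

/-! ### The truncated Gaussian mechanism over an unknown domain -/

/-- A released set of pairs (element, noisy count). It is a structure of its own because the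
σ-algebra needed here is not the cylinder σ-algebra that `Finset` carries. -/
@[ext] structure Release (U : Type*) where
  entries : Finset (U × ℝ)

/-- The σ-algebra generated by the events "an entry of `S` has the element `a` and a noisy count
in `B`", for elements `a` and Borel sets `B`. -/
instance Release.instMeasurableSpace (U : Type*) : MeasurableSpace (Release U) :=
  MeasurableSpace.generateFrom
    {A | ∃ (a : U) (B : Set ℝ), MeasurableSet B ∧ A = {S | ∃ r ∈ B, (a, r) ∈ S.entries}}

namespace TruncGauss

variable {U : Type*}

/-- The elements of a histogram with nonzero count, sorted by decreasing count (ties are broken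
in an arbitrary fixed way). -/
def sortedElements (h : U →₀ ℕ) : List U :=
  h.support.toList.mergeSort fun a b => decide (h b ≤ h a)

/-- The `i`-th largest count `h_(i)` (counted from `0`); it is `0` beyond the support of `h`. -/
def sortedCount (h : U →₀ ℕ) (i : ℕ) : ℕ :=
  match (sortedElements h)[i]? with
  | some a => h a
  | none => 0

/-- The returned set: the pairs of the `i`-th element and its noisy count `v i`, for those `i`
with `v i > τ + T`. Ranks `i` beyond the support of `h` have count `0` and carry no element: as
their noisy count is at most `T` they contribute nothing. -/
def release (dbar : ℕ) (τ T : ℝ) (h : U →₀ ℕ) (v : Fin dbar → ℝ) : Release U :=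
  open Classical in
  ⟨Finset.univ.biUnion fun i : Fin dbar =>
    match (sortedElements h)[(i : ℕ)]? with
    | some a => if v i > τ + T then {(a, v i)} else ∅
    | none => ∅⟩

theorem measurable_release (dbar : ℕ) (τ T : ℝ) (h : U →₀ ℕ) :
    Measurable (release dbar τ T h) := by
  classical
  refine measurable_generateFrom ?_
  rintro A ⟨a, B, hB, rfl⟩
  have : release dbar τ T h ⁻¹' {S | ∃ r ∈ B, (a, r) ∈ S.entries} =
      ⋃ i : Fin dbar, ⋃ _ : (sortedElements h)[(i : ℕ)]? = some a,
        (fun v : Fin dbar → ℝ => v i) ⁻¹' (B ∩ Set.Ioi (τ + T)) := by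
    ext v
    simp only [release, Set.mem_preimage, Set.mem_ofPred_eq, Finset.mem_biUnion, Finset.mem_univ,
      true_and, Set.mem_iUnion, exists_prop, Set.mem_inter_iff, Set.mem_Ioi]
    constructor
    · rintro ⟨r, hr, i, hi⟩
      refine ⟨i, ?_⟩
      split at hi
      · rename_i b hb
        split_ifs at hi with hv
        · simp only [Finset.mem_singleton, Prod.mk.injEq] at hi
          obtain ⟨rfl, rfl⟩ := hi
          exact ⟨hb, hr, hv⟩
        · simp at hi
      · simp at hi
    · rintro ⟨i, hi, hvB, hv⟩
      refine ⟨v i, hvB, i, ?_⟩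
      rw [hi]
      simp [hv]
  rw [this]
  exact MeasurableSet.iUnion fun i => MeasurableSet.iUnion fun _ =>
    measurable_pi_apply i (hB.inter measurableSet_Ioi)

/-- The mechanism `TruncGauss^{Δ, dbar, τ}` with truncation level `T`: it draws independent
`v_i ∼ TruncNormal_T(h_(i), τ² σ²)` for the `dbar` largest counts of the histogram `h`, and returns
the elements with noisy count above `τ + T`, together with these noisy counts. (The parameters `Δ`
and `δ` enter through `T`, see `IsTruncationLevel`.) -/
def mechanism (U : Type*) (dbar : ℕ) {τ σ T : ℝ} (hτ : 0 < τ) (hσ : 0 < σ) (hT : 0 < T) :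
    RandomizedAlgorithm (U →₀ ℕ) (Fin dbar → ℝ) (Release U) where
  prob h := Measure.pi fun i : Fin dbar => truncNormal T (sortedCount h i) (τ * σ)
  isProbabilityMeasure_prob h := by
    have : ∀ i : Fin dbar,
        IsProbabilityMeasure (truncNormal T (sortedCount h i) (τ * σ)) := fun i =>
      isProbabilityMeasure_truncNormal hT (mul_pos hτ hσ) _
    infer_instance
  out h := release dbar τ T h
  measurable_out h := measurable_release dbar τ T h

/-- `T` solves the equation that sets the truncation level. -/
def IsTruncationLevel (Δ : ℕ) (τ σ δ T : ℝ) : Prop :=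
  δ = Δ * (1 -
    (stdNormalCDF (T / (τ * σ)) - stdNormalCDF ((τ - T) / (τ * σ))) /
      (stdNormalCDF (T / (τ * σ)) - stdNormalCDF (-T / (τ * σ))))

end TruncGauss

/-! ### Sensitivity of a histogram -/

/-- On neighbouring datasets at most `Δ` counts of the histogram differ. -/
def HasL0Sensitivity {X U : Type*} (nbr : X → X → Prop) (hist : X → U →₀ ℕ) (Δ : ℕ) : Prop :=
  ∀ x x', nbr x x' → {a | hist x a ≠ hist x' a}.ncard ≤ Δ

/-- On neighbouring datasets every count of the histogram differs by at most `τ`. -/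
def HasLInftySensitivity {X U : Type*} (nbr : X → X → Prop) (hist : X → U →₀ ℕ) (τ : ℝ) : Prop :=
  ∀ x x', nbr x x' → ∀ a, |(hist x a : ℝ) - hist x' a| ≤ τ

end

/-!
Condition the run on each dataset on the event that every noisy count lies within `T` of the count
of the same element in the other dataset. At most `Δ` counts change, so this event has probability
at least `r ^ Δ`, where `δ = Δ * (1 - r)`, and `1 - δ ≤ r ^ Δ` is Bernoulli's inequality. On the
event an element missing from the other dataset has noisy count at most `T`, hence is not released,
and the output is the same function, for both datasets, of independent Gaussians indexed by the
common elements and conditioned on common windows. By data processing and additivity of the Rényi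
divergence it remains to compare two Gaussians with means `p` and `q`, conditioned on an interval
that is symmetric about `(p + q) / 2`. The moment of order `α` of their likelihood ratio is that of
the unconditioned Gaussians multiplied by the ratio of the masses that the Gaussians with means
`α * p + (1 - α) * q` and `q` give to the interval (complete the square). As the former mean is
farther from the midpoint than `q`, this ratio is at most `1`, so truncation does not increase the
divergence.
-/

open scoped NNReal

section RenyiDivergence

variable {Z Y : Type*} [MeasurableSpace Z] [MeasurableSpace Y] {P Q : Measure Z} {α : ℝ}

theorem lintegral_rnDeriv_rpow_sub_one [P.HaveLebesgueDecomposition Q] (hPQ : P ≪ Q)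
    (hα : 1 ≤ α) :
    ∫⁻ z, P.rnDeriv Q z ^ (α - 1) ∂P = ∫⁻ z, P.rnDeriv Q z ^ α ∂Q := by
  rw [← lintegral_rnDeriv_mul hPQ (by fun_prop)]
  refine lintegral_congr fun z => ?_
  nth_rw 1 [← ENNReal.rpow_one (P.rnDeriv Q z)]
  rw [← ENNReal.rpow_add_of_nonneg _ _ zero_le_one (sub_nonneg.mpr hα), add_sub_cancel]

theorem lintegral_ofReal_toReal_rnDeriv_rpow [SigmaFinite P] (hα : 0 ≤ α) :
    ∫⁻ z, ENNReal.ofReal ((P.rnDeriv Q z).toReal ^ α) ∂Q = ∫⁻ z, P.rnDeriv Q z ^ α ∂Q := by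
  refine lintegral_congr_ae ?_
  filter_upwards [P.rnDeriv_ne_top Q] with z hz
  rw [← ENNReal.ofReal_rpow_of_nonneg ENNReal.toReal_nonneg hα, ENNReal.ofReal_toReal hz]

theorem renyiDiv_le_coe_iff [P.HaveLebesgueDecomposition Q] (hα : 1 < α) {c : ℝ} :
    renyiDiv α P Q ≤ (c : EReal) ↔
      P ≪ Q ∧ ∫⁻ z, P.rnDeriv Q z ^ α ∂Q ≤ ENNReal.ofReal (Real.exp ((α - 1) * c)) := by
  have hα' : (0 : EReal) < ((α - 1 : ℝ) : EReal) := by exact_mod_cast sub_pos.mpr hα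
  by_cases hPQ : P ≪ Q
  · rw [renyiDiv, if_pos hPQ, lintegral_rnDeriv_rpow_sub_one hPQ hα.le, EReal.coe_inv, mul_comm,
      ← div_eq_mul_inv, EReal.div_le_iff_le_mul hα' (EReal.coe_ne_top _), ← EReal.coe_mul,
      ← Real.log_exp ((α - 1) * c), ← ENNReal.log_ofReal_of_pos (Real.exp_pos _),
      ENNReal.log_le_log_iff, and_iff_right hPQ]
    simp only [Real.log_exp]
  · simp only [renyiDiv, hPQ, if_false, top_le_iff, EReal.coe_ne_top, false_and]

theorem renyiDiv_withDensity_le [SigmaFinite Q] {f : Z → ℝ≥0∞} (hf : Measurable f) (hα : 1 < α)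
    {c : ℝ} (h : ∫⁻ z, f z ^ α ∂Q ≤ ENNReal.ofReal (Real.exp ((α - 1) * c))) :
    renyiDiv α (Q.withDensity f) Q ≤ (c : EReal) := by
  refine (renyiDiv_le_coe_iff hα).mpr ⟨withDensity_absolutelyContinuous Q f, le_of_eq_of_le ?_ h⟩
  refine lintegral_congr_ae ?_
  filter_upwards [Q.rnDeriv_withDensity hf] with z hz
  rw [hz]

theorem measurable_toReal_rnDeriv_rpow (P Q : Measure Z) (α : ℝ) :
    Measurable fun z => (P.rnDeriv Q z).toReal ^ α :=
  (Measure.measurable_rnDeriv P Q).ennreal_toReal.pow_const α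

theorem lintegral_rnDeriv_map_rpow_le [IsFiniteMeasure P] [IsFiniteMeasure Q] (hPQ : P ≪ Q)
    {g : Z → Y} (hg : Measurable g) (hα : 1 ≤ α) :
    ∫⁻ y, (P.map g).rnDeriv (Q.map g) y ^ α ∂(Q.map g) ≤ ∫⁻ z, P.rnDeriv Q z ^ α ∂Q := by
  have hα₀ : 0 ≤ α := zero_le_one.trans hα
  have hcvx := convexOn_rpow hα
  have hpow : StronglyMeasurable fun t : ℝ => t ^ α := by fun_prop
  have hcont : ContinuousWithinAt (fun t : ℝ => t ^ α) (Set.Ici 0) 0 :=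
    (Real.continuous_rpow_const hα₀).continuousWithinAt
  have hmeas := (measurable_toReal_rnDeriv_rpow P Q α).aestronglyMeasurable (μ := Q)
  have hnonneg : 0 ≤ᵐ[Q] fun z => (P.rnDeriv Q z).toReal ^ α := ae_of_all _ fun _ => by positivity
  rw [← lintegral_ofReal_toReal_rnDeriv_rpow hα₀, ← lintegral_ofReal_toReal_rnDeriv_rpow hα₀]
  by_cases hint : Integrable (fun z => (P.rnDeriv Q z).toReal ^ α) Q
  · have hint_map := hcvx.integrable_comp_rnDeriv_map hPQ hg hpow hcont hint
    rw [← ofReal_integral_eq_lintegral_ofReal hint_map (ae_of_all _ fun _ => by positivity),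
      ← ofReal_integral_eq_lintegral_ofReal hint hnonneg]
    refine ENNReal.ofReal_le_ofReal ?_
    calc ∫ y, ((P.map g).rnDeriv (Q.map g) y).toReal ^ α ∂(Q.map g)
        = ∫ z, ((P.map g).rnDeriv (Q.map g) (g z)).toReal ^ α ∂Q :=
          integral_map hg.aemeasurable
            (measurable_toReal_rnDeriv_rpow _ _ α).aestronglyMeasurable
      _ ≤ ∫ z, (Q[fun z => (P.rnDeriv Q z).toReal ^ α |
            MeasurableSpace.comap g inferInstance]) z ∂Q :=
          integral_mono_ae (hint_map.comp_measurable hg) integrable_condExp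
            (hcvx.comp_rnDeriv_map_le hPQ hg hpow hcont hint)
      _ = ∫ z, (P.rnDeriv Q z).toReal ^ α ∂Q := integral_condExp hg.comap_le
  · rw [← lintegral_ofReal_ne_top_iff_integrable hmeas hnonneg, not_not] at hint
    exact hint ▸ le_top

theorem renyiDiv_map_le [IsFiniteMeasure P] [IsFiniteMeasure Q] {g : Z → Y} (hg : Measurable g)
    (hα : 1 < α) : renyiDiv α (P.map g) (Q.map g) ≤ renyiDiv α P Q := by
  by_cases hPQ : P ≪ Q
  · rw [renyiDiv, renyiDiv, if_pos hPQ, if_pos (hPQ.map hg),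
      lintegral_rnDeriv_rpow_sub_one hPQ hα.le, lintegral_rnDeriv_rpow_sub_one (hPQ.map hg) hα.le]
    refine mul_le_mul_of_nonneg_left
      (ENNReal.log_le_log (lintegral_rnDeriv_map_rpow_le hPQ hg hα.le)) ?_
    exact_mod_cast (inv_pos.mpr (sub_pos.mpr hα)).le
  · rw [renyiDiv, renyiDiv, if_neg hPQ]
    exact le_top

end RenyiDivergence

section ProductMeasures

theorem indicator_univ_pi_prod {ι : Type*} [Fintype ι] {E : ι → Type*} (s : ∀ i, Set (E i))
    (f : ∀ i, E i → ℝ≥0∞) (w : ∀ i, E i) :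
    (Set.univ.pi s).indicator (fun w => ∏ i, f i (w i)) w = ∏ i, (s i).indicator (f i) (w i) := by
  by_cases hw : w ∈ Set.univ.pi s
  · rw [Set.indicator_of_mem hw]
    exact Finset.prod_congr rfl fun i _ => (Set.indicator_of_mem (hw i trivial) _).symm
  · rw [Set.indicator_of_notMem hw]
    simp only [Set.mem_univ_pi, not_forall] at hw
    obtain ⟨i, hi⟩ := hw
    exact (Finset.prod_eq_zero (Finset.mem_univ i) (Set.indicator_of_notMem hi _)).symm

variable {ι : Type*} [Fintype ι] {E : ι → Type*} [∀ i, MeasurableSpace (E i)]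
  (μ : ∀ i, Measure (E i)) [∀ i, IsProbabilityMeasure (μ i)]

theorem lintegral_pi_prod {f : ∀ i, E i → ℝ≥0∞} (hf : ∀ i, Measurable (f i)) :
    ∫⁻ w, ∏ i, f i (w i) ∂(Measure.pi μ) = ∏ i, ∫⁻ z, f i z ∂(μ i) := by
  calc ∫⁻ w, ∏ i, f i (w i) ∂(Measure.pi μ)
      = ∏ i, ∫⁻ w, f i (w i) ∂(Measure.pi μ) :=
        lintegral_prod_eq_prod_lintegral_of_indepFun Finset.univ
          (fun i (w : ∀ i, E i) => f i (w i)) (iIndepFun_pi fun i => (hf i).aemeasurable)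
          fun i => (hf i).comp (measurable_pi_apply i)
    _ = ∏ i, ∫⁻ z, f i z ∂(μ i) :=
        Finset.prod_congr rfl fun i _ => (measurePreserving_eval μ i).lintegral_comp (hf i)

theorem pi_withDensity {f : ∀ i, E i → ℝ≥0∞} (hf : ∀ i, Measurable (f i))
    [∀ i, SigmaFinite ((μ i).withDensity (f i))] :
    Measure.pi (fun i => (μ i).withDensity (f i)) =
      (Measure.pi μ).withDensity fun w => ∏ i, f i (w i) := by
  refine Measure.pi_eq fun s hs => ?_
  rw [withDensity_apply _ (MeasurableSet.univ_pi hs),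
    ← lintegral_indicator (MeasurableSet.univ_pi hs)]
  simp_rw [indicator_univ_pi_prod]
  rw [lintegral_pi_prod μ fun i => (hf i).indicator (hs i)]
  exact Finset.prod_congr rfl fun i _ => by
    rw [lintegral_indicator (hs i), withDensity_apply _ (hs i)]

theorem cond_pi {s : ∀ i, Set (E i)} (hs : ∀ i, MeasurableSet (s i)) :
    (Measure.pi μ)[|Set.univ.pi s] = Measure.pi fun i => (μ i)[|s i] := by
  refine (Measure.pi_eq fun t _ => ?_).symm
  rw [cond_apply (MeasurableSet.univ_pi hs), ← Set.pi_inter_distrib, Measure.pi_pi,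
    Measure.pi_pi, ENNReal.prod_inv_distrib, ← Finset.prod_mul_distrib]
  · exact Finset.prod_congr rfl fun i _ => (cond_apply (hs i) _ _).symm
  · exact fun i _ j _ _ => Or.inr (measure_ne_top _ _)

theorem map_pi_precomp {κ : Type*} [Fintype κ] {e : κ → ι} (he : Function.Injective e) :
    (Measure.pi μ).map (fun w k => w (e k)) = Measure.pi fun k => μ (e k) := by
  have hind := (iIndepFun_pi (μ := μ) (X := fun i z => z) fun i => aemeasurable_id).precomp he
  rw [iIndepFun_iff_map_fun_eq_pi_map fun k => (measurable_pi_apply (e k)).aemeasurable] at hind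
  refine hind.trans (congrArg Measure.pi (funext fun k => ?_))
  exact (measurePreserving_eval μ (e k)).map_eq

theorem renyiDiv_pi_le (ν : ∀ i, Measure (E i)) [∀ i, IsProbabilityMeasure (ν i)] {α : ℝ}
    (hα : 1 < α) {c : ι → ℝ} (h : ∀ i, renyiDiv α (μ i) (ν i) ≤ (c i : EReal)) :
    renyiDiv α (Measure.pi μ) (Measure.pi ν) ≤ ((∑ i, c i : ℝ) : EReal) := by
  simp only [renyiDiv_le_coe_iff hα] at h
  have hdensity : ∀ i, (ν i).withDensity ((μ i).rnDeriv (ν i)) = μ i := fun i =>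
    Measure.withDensity_rnDeriv_eq _ _ (h i).1
  have hpi : Measure.pi μ = (Measure.pi ν).withDensity fun w => ∏ i, (μ i).rnDeriv (ν i) (w i) := by
    have : ∀ i, SigmaFinite ((ν i).withDensity ((μ i).rnDeriv (ν i))) := fun i =>
      (hdensity i).symm ▸ inferInstance
    simp only [← pi_withDensity ν fun i => Measure.measurable_rnDeriv (μ i) (ν i), hdensity]
  rw [hpi]
  refine renyiDiv_withDensity_le (by fun_prop) hα ?_
  simp_rw [← ENNReal.prod_rpow_of_nonneg (zero_le_one.trans hα.le)]
  rw [lintegral_pi_prod ν fun i => (Measure.measurable_rnDeriv (μ i) (ν i)).pow_const α,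
    Finset.mul_sum, Real.exp_sum, ENNReal.ofReal_prod_of_nonneg fun _ _ => (Real.exp_pos _).le]
  exact Finset.prod_le_prod' fun i _ => (h i).2

end ProductMeasures

theorem cond_withDensity {Z : Type*} [MeasurableSpace Z] {Q : Measure Z} {f : Z → ℝ≥0∞}
    {A : Set Z} (hA : MeasurableSet A) (h : Q.withDensity f A = Q A) :
    (Q.withDensity f)[|A] = (Q[|A]).withDensity f := by
  rw [ProbabilityTheory.cond, ProbabilityTheory.cond, h, restrict_withDensity hA,
    withDensity_smul_measure]

section Gaussian

variable {v : ℝ≥0}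

theorem gaussianReal_const_sub_apply (c m : ℝ) {A : Set ℝ} (hA : MeasurableSet A) :
    gaussianReal (c - m) v A = gaussianReal m v ((fun z => c - z) ⁻¹' A) := by
  rw [← gaussianReal_map_const_sub c, Measure.map_apply (by fun_prop) hA]

theorem gaussianReal_Icc_reflect (m a b : ℝ) :
    gaussianReal (a + b - m) v (Set.Icc a b) = gaussianReal m v (Set.Icc a b) := by
  rw [gaussianReal_const_sub_apply _ _ measurableSet_Icc, Set.preimage_const_sub_Icc,
    add_sub_cancel_right, add_sub_cancel_left]

theorem gaussianReal_le_of_subset_Iic (hv : v ≠ 0) {p m : ℝ} (hpm : p ≤ m) {A : Set ℝ}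
    (hA : A ⊆ Set.Iic ((p + m) / 2)) : gaussianReal m v A ≤ gaussianReal p v A := by
  rw [gaussianReal_apply _ hv, gaussianReal_apply _ hv]
  refine setLIntegral_mono (measurable_gaussianPDF p v) fun z hz => ENNReal.ofReal_le_ofReal ?_
  have hdist : (z - p) ^ 2 ≤ (z - m) ^ 2 := by
    nlinarith [mul_nonneg (sub_nonneg.mpr hpm) (sub_nonneg.mpr (Set.mem_Iic.mp (hA hz)))]
  simp only [gaussianPDFReal]
  gcongr

theorem gaussianReal_Icc_anti (hv : v ≠ 0) {a b p m : ℝ}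
    (h : |2 * p - (a + b)| ≤ |2 * m - (a + b)|) :
    gaussianReal m v (Set.Icc a b) ≤ gaussianReal p v (Set.Icc a b) := by
  wlog hpm : p < m generalizing p m
  · rcases (not_lt.mp hpm).eq_or_lt with rfl | hmp
    · exact le_rfl
    · rw [← gaussianReal_Icc_reflect m, ← gaussianReal_Icc_reflect p]
      refine this ?_ (sub_lt_sub_left hmp _)
      rwa [show 2 * (a + b - p) - (a + b) = -(2 * p - (a + b)) by ring, abs_neg,
        show 2 * (a + b - m) - (a + b) = -(2 * m - (a + b)) by ring, abs_neg]
  have hmid : a + b ≤ p + m := by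
    nlinarith [sq_le_sq.mpr h]
  set I := Set.Icc a b
  set J := (fun z => p + m - z) ⁻¹' I with hJ
  have hJmeas : MeasurableSet J := measurableSet_Icc.preimage (by fun_prop)
  have hswap : (fun z => p + m - z) ⁻¹' (I ∩ J) = I ∩ J := by
    rw [Set.preimage_inter, ← hJ, hJ, ← Set.preimage_comp]
    simp only [Function.comp_def, sub_sub_cancel, Set.preimage_id', Set.inter_comm]
  have hinter : gaussianReal p v (I ∩ J) = gaussianReal m v (I ∩ J) := by
    rw [← hswap, ← gaussianReal_const_sub_apply _ _ (measurableSet_Icc.inter hJmeas), hswap,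
      add_sub_cancel_left]
  have hdiff : I \ J ⊆ Set.Iic ((p + m) / 2) := by
    rintro z ⟨⟨-, hzb⟩, hzJ⟩
    by_contra hz
    rw [Set.mem_Iic, not_le] at hz
    exact hzJ ⟨by linarith, by linarith⟩
  rw [← measure_inter_add_sdiff I hJmeas, ← measure_inter_add_sdiff I hJmeas, hinter]
  exact add_le_add_right (gaussianReal_le_of_subset_Iic hv hpm.le hdiff) _

/-- The likelihood ratio of the Gaussians with means `p` and `q` and common variance `v ≠ 0`, as a
density of the former with respect to the latter. It is an everywhere defined version of the
Radon-Nikodym derivative, with explicit powers. -/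
noncomputable def gaussianLikelihoodRatio (p q : ℝ) (v : ℝ≥0) (z : ℝ) : ℝ≥0∞ :=
  ENNReal.ofReal (Real.exp (((z - q) ^ 2 - (z - p) ^ 2) / (2 * v)))

theorem measurable_gaussianLikelihoodRatio (p q : ℝ) (v : ℝ≥0) :
    Measurable (gaussianLikelihoodRatio p q v) := by
  unfold gaussianLikelihoodRatio
  fun_prop

theorem withDensity_gaussianLikelihoodRatio (hv : v ≠ 0) (p q : ℝ) :
    (gaussianReal q v).withDensity (gaussianLikelihoodRatio p q v) = gaussianReal p v := by
  rw [gaussianReal_of_var_ne_zero _ hv, gaussianReal_of_var_ne_zero _ hv, ← withDensity_mul _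
    (measurable_gaussianPDF _ _) (measurable_gaussianLikelihoodRatio p q v)]
  refine congrArg _ (funext fun z => ?_)
  rw [Pi.mul_apply, gaussianPDF, gaussianPDF, gaussianLikelihoodRatio,
    ← ENNReal.ofReal_mul (gaussianPDFReal_nonneg _ _ _), gaussianPDFReal, gaussianPDFReal,
    mul_assoc, ← Real.exp_add, ← add_div, neg_add_eq_sub, sub_sub_cancel_left]

theorem gaussianLikelihoodRatio_rpow (p q z α : ℝ) :
    gaussianLikelihoodRatio p q v z ^ α =
      ENNReal.ofReal (Real.exp ((α - 1) * (α * ((p - q) ^ 2 / (2 * v))))) *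
        gaussianLikelihoodRatio (α * p + (1 - α) * q) q v z := by
  rw [gaussianLikelihoodRatio, gaussianLikelihoodRatio,
    ENNReal.ofReal_rpow_of_pos (Real.exp_pos _), ← ENNReal.ofReal_mul (Real.exp_pos _).le,
    ← Real.exp_mul, ← Real.exp_add]
  ring_nf

theorem lintegral_gaussianLikelihoodRatio_cond (hv : v ≠ 0) (p q : ℝ) {A : Set ℝ}
    (hA : MeasurableSet A) :
    ∫⁻ z, gaussianLikelihoodRatio p q v z ∂((gaussianReal q v)[|A]) =
      gaussianReal p v A / gaussianReal q v A := by
  rw [ProbabilityTheory.cond, lintegral_smul_measure, ← withDensity_apply _ hA,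
    withDensity_gaussianLikelihoodRatio hv, smul_eq_mul, mul_comm, div_eq_mul_inv]

theorem renyiDiv_cond_gaussianReal_le (hv : v ≠ 0) {p q a b α : ℝ} (hab : a + b = p + q)
    (hα : 1 < α) :
    renyiDiv α ((gaussianReal p v)[|Set.Icc a b]) ((gaussianReal q v)[|Set.Icc a b]) ≤
      ((α * ((p - q) ^ 2 / (2 * v)) : ℝ) : EReal) := by
  set m := α * p + (1 - α) * q with hm
  have hmass : gaussianReal p v (Set.Icc a b) = gaussianReal q v (Set.Icc a b) := by
    rw [← gaussianReal_Icc_reflect q, hab, add_sub_cancel_right]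
  have hmass_le : gaussianReal m v (Set.Icc a b) ≤ gaussianReal q v (Set.Icc a b) := by
    refine gaussianReal_Icc_anti hv ?_
    rw [hab, hm, show 2 * q - (p + q) = -(p - q) by ring, abs_neg,
      show 2 * (α * p + (1 - α) * q) - (p + q) = (2 * α - 1) * (p - q) by ring, abs_mul,
      abs_of_pos (by linarith : 0 < 2 * α - 1)]
    exact le_mul_of_one_le_left (abs_nonneg _) (by linarith)
  rw [← withDensity_gaussianLikelihoodRatio hv p q, cond_withDensity measurableSet_Icc
    (by rwa [withDensity_gaussianLikelihoodRatio hv])]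
  refine renyiDiv_withDensity_le (measurable_gaussianLikelihoodRatio p q v) hα ?_
  simp_rw [gaussianLikelihoodRatio_rpow]
  rw [lintegral_const_mul _ (measurable_gaussianLikelihoodRatio _ q v),
    lintegral_gaussianLikelihoodRatio_cond hv _ _ measurableSet_Icc]
  exact mul_le_of_le_one_right' (ENNReal.div_le_of_le_mul (by rwa [one_mul]))

end Gaussian

section TruncatedNormal

variable {T s : ℝ}

theorem strictMono_stdNormalCDF : StrictMono stdNormalCDF := fun _ _ => stdNormalCDF_lt

theorem stdNormalCDF_sub_neg_pos (hT : 0 < T) (hs : 0 < s) :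
    0 < stdNormalCDF (T / s) - stdNormalCDF (-T / s) :=
  sub_pos.mpr (stdNormalCDF_lt (div_lt_div_of_pos_right (by linarith) hs))

theorem mk_sq_ne_zero (hs : s ≠ 0) : NNReal.mk (s ^ 2) (sq_nonneg _) ≠ 0 := fun h =>
  pow_ne_zero 2 hs (congrArg NNReal.toReal h)

theorem stdNormalPDF_sub_div (hs : 0 < s) (m z : ℝ) :
    stdNormalPDF ((z - m) / s) = s * gaussianPDFReal m (.mk (s ^ 2) (sq_nonneg _)) z := by
  rw [stdNormalPDF, div_eq_inv_mul, gaussianPDFReal_inv_mul hs.ne', gaussianPDFReal_sub,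
    abs_of_pos hs, mul_zero, zero_add, mul_one]

theorem gaussianReal_map_sub_div (hs : s ≠ 0) (m : ℝ) :
    (gaussianReal m (.mk (s ^ 2) (sq_nonneg _))).map (fun z => (z - m) / s) =
      gaussianReal 0 1 := by
  rw [show (fun z : ℝ => (z - m) / s) = (fun z => z / s) ∘ fun z => z - m from rfl,
    ← Measure.map_map (by fun_prop) (by fun_prop), gaussianReal_map_sub_const,
    gaussianReal_map_div_const, sub_self, zero_div, div_self (mk_sq_ne_zero hs)]

theorem gaussianReal_Icc_eq_stdNormalCDF_sub (hs : 0 < s) (m : ℝ) {a b : ℝ} (hab : a ≤ b) :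
    gaussianReal m (.mk (s ^ 2) (sq_nonneg _)) (Set.Icc a b) =
      ENNReal.ofReal (stdNormalCDF ((b - m) / s) - stdNormalCDF ((a - m) / s)) := by
  rw [← stdNormalCDF_sub (by gcongr), ← gaussianReal_map_sub_div hs.ne' m,
    Measure.map_apply (by fun_prop) measurableSet_Icc]
  congr 1
  ext z
  simp only [Set.mem_preimage, Set.mem_Icc, div_le_div_iff_of_pos_right hs, sub_le_sub_iff_right]

theorem truncNormal_eq_cond (hT : 0 < T) (hs : 0 < s) (m : ℝ) :
    truncNormal T m s =
      (gaussianReal m (.mk (s ^ 2) (sq_nonneg _)))[|Set.Icc (m - T) (m + T)] := by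
  have hmass := stdNormalCDF_sub_neg_pos hT hs
  rw [ProbabilityTheory.cond, gaussianReal_Icc_eq_stdNormalCDF_sub hs m (by linarith),
    sub_sub_cancel_left, add_sub_cancel_left, ← ENNReal.ofReal_inv_of_pos hmass,
    gaussianReal_of_var_ne_zero _ (mk_sq_ne_zero hs.ne'), restrict_withDensity measurableSet_Icc,
    ← withDensity_indicator measurableSet_Icc,
    ← withDensity_smul _ ((measurable_gaussianPDF _ _).indicator measurableSet_Icc), truncNormal]
  refine congrArg _ (funext fun z => ?_)
  rw [Pi.smul_apply, smul_eq_mul, truncNormalPDF]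
  by_cases hz : z ∈ Set.Icc (m - T) (m + T)
  · rw [if_pos (Set.mem_Icc.mp hz), Set.indicator_of_mem hz, gaussianPDF,
      ← ENNReal.ofReal_mul (by positivity), stdNormalPDF_sub_div hs]
    congr 1
    field_simp
  · rw [if_neg (mt Set.mem_Icc.mpr hz), Set.indicator_of_notMem hz, ENNReal.ofReal_zero, mul_zero]

/-- The values within `T` of both `m` and `n`, that is, the common support of the Gaussians with
means `m` and `n` truncated at level `T`. -/
def commonWindow (T m n : ℝ) : Set ℝ :=
  Set.Icc (m - T) (m + T) ∩ Set.Icc (n - T) (n + T)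

theorem measurableSet_commonWindow (T m n : ℝ) : MeasurableSet (commonWindow T m n) :=
  measurableSet_Icc.inter measurableSet_Icc

theorem commonWindow_comm (T m n : ℝ) : commonWindow T m n = commonWindow T n m :=
  Set.inter_comm _ _

theorem commonWindow_eq_Icc (T m n : ℝ) :
    commonWindow T m n = Set.Icc (max m n - T) (min m n + T) := by
  rw [commonWindow, Set.Icc_inter_Icc, ← max_sub_sub_right, ← min_add_add_right]

theorem cond_truncNormal_commonWindow (hT : 0 < T) (hs : 0 < s) (m n : ℝ) :
    (truncNormal T m s)[|commonWindow T m n] =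
      (gaussianReal m (.mk (s ^ 2) (sq_nonneg _)))[|commonWindow T m n] := by
  rw [truncNormal_eq_cond hT hs, cond_cond_eq_cond_inter measurableSet_Icc
    (measurableSet_commonWindow T m n), commonWindow, ← Set.inter_assoc, Set.inter_self]

/-- The probability that a truncated Gaussian of standard deviation `s` falls within the truncation
window of another one whose mean is at distance `d`, see `truncNormal_commonWindow`. -/
noncomputable def overlapProb (T s d : ℝ) : ℝ :=
  (stdNormalCDF (T / s) - stdNormalCDF ((d - T) / s)) /
    (stdNormalCDF (T / s) - stdNormalCDF (-T / s))

theorem overlapProb_zero (hT : 0 < T) (hs : 0 < s) : overlapProb T s 0 = 1 := by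
  rw [overlapProb, zero_sub, div_self (stdNormalCDF_sub_neg_pos hT hs).ne']

theorem antitone_overlapProb (hT : 0 < T) (hs : 0 < s) : Antitone (overlapProb T s) := by
  intro d d' hdd'
  have hmass := stdNormalCDF_sub_neg_pos hT hs
  unfold overlapProb
  gcongr
  exact strictMono_stdNormalCDF.monotone (by gcongr)

theorem overlapProb_pos_iff (hT : 0 < T) (hs : 0 < s) {d : ℝ} :
    0 < overlapProb T s d ↔ d < 2 * T := by
  rw [overlapProb, div_pos_iff_of_pos_right (stdNormalCDF_sub_neg_pos hT hs), sub_pos,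
    strictMono_stdNormalCDF.lt_iff_lt, div_lt_div_iff_of_pos_right hs, sub_lt_iff_lt_add, two_mul]

theorem gaussianReal_commonWindow_comm (v : ℝ≥0) (T m n : ℝ) :
    gaussianReal m v (commonWindow T m n) = gaussianReal n v (commonWindow T m n) := by
  rw [commonWindow_eq_Icc, ← gaussianReal_Icc_reflect, sub_add_add_cancel, max_add_min,
    add_sub_cancel_left]

theorem gaussianReal_commonWindow (hs : 0 < s) {m n : ℝ} (hmn : |m - n| ≤ 2 * T) :
    gaussianReal m (.mk (s ^ 2) (sq_nonneg _)) (commonWindow T m n) =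
      ENNReal.ofReal (stdNormalCDF (T / s) - stdNormalCDF ((|m - n| - T) / s)) := by
  wlog hle : m ≤ n generalizing m n
  · rw [gaussianReal_commonWindow_comm, commonWindow_comm, abs_sub_comm,
      this (by rwa [abs_sub_comm]) (le_of_not_ge hle)]
  rw [abs_of_nonpos (sub_nonpos.mpr hle)] at hmn ⊢
  rw [commonWindow_eq_Icc, max_eq_right hle, min_eq_left hle,
    gaussianReal_Icc_eq_stdNormalCDF_sub hs m (by linarith), add_sub_cancel_left, neg_sub,
    sub_right_comm]

theorem gaussianReal_commonWindow_ne_zero (hs : 0 < s) {m n : ℝ} (hmn : |m - n| < 2 * T) :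
    gaussianReal m (.mk (s ^ 2) (sq_nonneg _)) (commonWindow T m n) ≠ 0 := by
  rw [gaussianReal_commonWindow hs hmn.le]
  exact (ENNReal.ofReal_pos.mpr (sub_pos.mpr (stdNormalCDF_lt
    (div_lt_div_of_pos_right (by linarith) hs)))).ne'

theorem truncNormal_commonWindow (hT : 0 < T) (hs : 0 < s) {m n : ℝ} (hmn : |m - n| ≤ 2 * T) :
    truncNormal T m s (commonWindow T m n) = ENNReal.ofReal (overlapProb T s |m - n|) := by
  have hsubset : commonWindow T m n ⊆ Set.Icc (m - T) (m + T) := Set.inter_subset_left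
  rw [truncNormal_eq_cond hT hs, cond_apply measurableSet_Icc, Set.inter_eq_right.mpr hsubset,
    gaussianReal_commonWindow hs hmn, gaussianReal_Icc_eq_stdNormalCDF_sub hs m (by linarith),
    sub_sub_cancel_left, add_sub_cancel_left, mul_comm, ← div_eq_mul_inv,
    ← ENNReal.ofReal_div_of_pos (stdNormalCDF_sub_neg_pos hT hs), overlapProb]

theorem truncNormal_commonWindow_ne_zero (hT : 0 < T) (hs : 0 < s) {m n : ℝ}
    (hmn : |m - n| < 2 * T) : truncNormal T m s (commonWindow T m n) ≠ 0 := by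
  rw [truncNormal_commonWindow hT hs hmn.le]
  exact (ENNReal.ofReal_pos.mpr ((overlapProb_pos_iff hT hs).mpr hmn)).ne'

theorem renyiDiv_cond_gaussianReal_commonWindow_le {v : ℝ≥0} (hv : v ≠ 0) (T m n : ℝ) {α : ℝ}
    (hα : 1 < α) :
    renyiDiv α ((gaussianReal m v)[|commonWindow T m n])
      ((gaussianReal n v)[|commonWindow T m n]) ≤ ((α * ((m - n) ^ 2 / (2 * v)) : ℝ) : EReal) := by
  rw [commonWindow_eq_Icc]
  exact renyiDiv_cond_gaussianReal_le hv (by rw [sub_add_add_cancel, max_add_min]) hα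

end TruncatedNormal

namespace TruncGauss

variable {U : Type*} {h k : U →₀ ℕ}

theorem nodup_sortedElements (h : U →₀ ℕ) : (sortedElements h).Nodup :=
  (List.mergeSort_perm _ _).nodup_iff.mpr h.support.nodup_toList

theorem mem_sortedElements {a : U} : a ∈ sortedElements h ↔ h a ≠ 0 := by
  rw [sortedElements, (List.mergeSort_perm _ _).mem_iff, Finset.mem_toList, Finsupp.mem_support_iff]

theorem length_sortedElements (h : U →₀ ℕ) : (sortedElements h).length = h.support.card := by
  rw [sortedElements, (List.mergeSort_perm _ _).length_eq, Finset.length_toList]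

theorem ne_zero_of_getElem?_sortedElements {i : ℕ} {a : U}
    (hi : (sortedElements h)[i]? = some a) : h a ≠ 0 :=
  mem_sortedElements.mp (List.mem_of_getElem? hi)

theorem getElem?_sortedElements_inj {i j : ℕ} {a : U} (hi : (sortedElements h)[i]? = some a)
    (hj : (sortedElements h)[j]? = some a) : i = j := by
  obtain ⟨hlt, -⟩ := List.getElem?_eq_some_iff.mp hi
  exact (List.getElem?_inj hlt (nodup_sortedElements h)).mp (hi.trans hj.symm)

theorem exists_getElem?_sortedElements {dbar : ℕ} (hd : h.support.card ≤ dbar) {a : U}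
    (ha : h a ≠ 0) : ∃ i : Fin dbar, (sortedElements h)[(i : ℕ)]? = some a := by
  obtain ⟨i, hi⟩ := List.mem_iff_getElem?.mp (mem_sortedElements.mpr ha)
  obtain ⟨hlt, -⟩ := List.getElem?_eq_some_iff.mp hi
  rw [length_sortedElements] at hlt
  exact ⟨⟨i, hlt.trans_le hd⟩, hi⟩

/-- The count in `k` of the element that has rank `i` in `h`; like `sortedCount h i`, it is `0`
beyond the support of `h`. -/
noncomputable def rankedCount (h k : U →₀ ℕ) (i : ℕ) : ℕ :=
  match (sortedElements h)[i]? with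
  | some a => k a
  | none => 0

theorem sortedCount_of_some {i : ℕ} {a : U} (hi : (sortedElements h)[i]? = some a) :
    sortedCount h i = h a := by
  rw [sortedCount, hi]

theorem rankedCount_of_some {i : ℕ} {a : U} (hi : (sortedElements h)[i]? = some a) :
    rankedCount h k i = k a := by
  rw [rankedCount, hi]

theorem exists_getElem?_of_sortedCount_ne_rankedCount {i : ℕ}
    (hne : sortedCount h i ≠ rankedCount h k i) :
    ∃ a, (sortedElements h)[i]? = some a ∧ h a ≠ k a := by
  cases hi : (sortedElements h)[i]? with
  | none => exact absurd (by rw [sortedCount, rankedCount, hi]) hne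
  | some a => exact ⟨a, rfl, by rwa [sortedCount_of_some hi, rankedCount_of_some hi] at hne⟩

theorem abs_sortedCount_sub_rankedCount_le {τ : ℝ} (hτ : 0 ≤ τ)
    (hhk : ∀ a, |(h a : ℝ) - k a| ≤ τ) (i : ℕ) :
    |(sortedCount h i : ℝ) - rankedCount h k i| ≤ τ := by
  cases hi : (sortedElements h)[i]? with
  | none => simpa only [sortedCount, rankedCount, hi, sub_self, abs_zero] using hτ
  | some a => simpa only [sortedCount_of_some hi, rankedCount_of_some hi] using hhk a

theorem finite_setOf_ne (h k : U →₀ ℕ) : {a | h a ≠ k a}.Finite := by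
  refine (h.hasFiniteSupport.union k.hasFiniteSupport).subset fun a hne => ?_
  by_contra! hnotMem
  simp only [Set.mem_union, Function.mem_support, not_or, not_not] at hnotMem
  exact hne (hnotMem.1.trans hnotMem.2.symm)

theorem card_sortedCount_ne_rankedCount_le (dbar : ℕ) (h k : U →₀ ℕ) :
    (Finset.univ.filter fun i : Fin dbar => sortedCount h i ≠ rankedCount h k i).card ≤
      {a | h a ≠ k a}.ncard := by
  rw [Set.ncard_eq_toFinset_card _ (finite_setOf_ne h k)]
  refine Finset.card_le_card_of_forall_subsingleton
    (fun (i : Fin dbar) a => (sortedElements h)[(i : ℕ)]? = some a) (fun i hi => ?_) ?_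
  · obtain ⟨a, ha, hne⟩ :=
      exists_getElem?_of_sortedCount_ne_rankedCount (Finset.mem_filter.mp hi).2
    exact ⟨a, (finite_setOf_ne h k).mem_toFinset.mpr hne, ha⟩
  · rintro a - i ⟨-, hi⟩ j ⟨-, hj⟩
    exact Fin.ext (getElem?_sortedElements_inj hi hj)

/-- The event, for the run of the mechanism on `h`, that every noisy count could also have been
obtained from the count in `k` of the same element. -/
def commonEvent (dbar : ℕ) (T : ℝ) (h k : U →₀ ℕ) : Set (Fin dbar → ℝ) :=
  Set.univ.pi fun i => commonWindow T (sortedCount h i) (rankedCount h k i)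

theorem measurableSet_commonEvent (dbar : ℕ) (T : ℝ) (h k : U →₀ ℕ) :
    MeasurableSet (commonEvent dbar T h k) :=
  MeasurableSet.univ_pi fun _ => measurableSet_commonWindow _ _ _

/-- The elements with nonzero count in both histograms. -/
noncomputable def commonElements (h k : U →₀ ℕ) : Finset U := (h * k).support

theorem mem_commonElements {a : U} : a ∈ commonElements h k ↔ h a ≠ 0 ∧ k a ≠ 0 := by
  rw [commonElements, Finsupp.mem_support_iff, Finsupp.mul_apply, mul_ne_zero_iff]

theorem commonElements_comm (h k : U →₀ ℕ) : commonElements h k = commonElements k h := by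
  rw [commonElements, mul_comm, commonElements]

/-- The pairs of an element of `K` and its noisy count, for the noisy counts above `θ`. On the
common event it describes the output of the mechanism without reference to the ranks, which differ
between two histograms. -/
noncomputable def releaseOn (K : Finset U) (θ : ℝ) (w : K → ℝ) : Release U :=
  open Classical in
  ⟨((Finset.univ : Finset K).filter fun a => θ < w a).image fun a : K => ((a : U), w a)⟩

theorem mem_releaseOn {K : Finset U} {θ : ℝ} {w : K → ℝ} {a : U} {r : ℝ} :
    (a, r) ∈ (releaseOn K θ w).entries ↔ ∃ ha : a ∈ K, w ⟨a, ha⟩ = r ∧ θ < r := by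
  simp only [releaseOn, Finset.mem_image, Finset.mem_filter, Finset.mem_univ, true_and,
    Prod.mk.injEq]
  constructor
  · rintro ⟨⟨b, hb⟩, hw, rfl, rfl⟩
    exact ⟨hb, rfl, hw⟩
  · rintro ⟨ha, rfl, hr⟩
    exact ⟨⟨a, ha⟩, hr, rfl, rfl⟩

theorem measurable_releaseOn (K : Finset U) (θ : ℝ) : Measurable (releaseOn K θ) := by
  refine measurable_generateFrom ?_
  rintro A ⟨a, B, hB, rfl⟩
  have hpreimage : releaseOn K θ ⁻¹' {S | ∃ r ∈ B, (a, r) ∈ S.entries} =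
      ⋃ ha : a ∈ K, (fun w : K → ℝ => w ⟨a, ha⟩) ⁻¹' (B ∩ Set.Ioi θ) := by
    ext w
    simp only [Set.mem_preimage, Set.mem_ofPred_eq, mem_releaseOn, Set.mem_iUnion,
      Set.mem_inter_iff, Set.mem_Ioi]
    constructor
    · rintro ⟨r, hr, ha, rfl, hθ⟩
      exact ⟨ha, hr, hθ⟩
    · rintro ⟨ha, hr, hθ⟩
      exact ⟨_, hr, ha, rfl, hθ⟩
  rw [hpreimage]
  exact MeasurableSet.iUnion fun ha => measurable_pi_apply _ (hB.inter measurableSet_Ioi)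

theorem mem_release {dbar : ℕ} {τ T : ℝ} {v : Fin dbar → ℝ} {a : U} {r : ℝ} :
    (a, r) ∈ (release dbar τ T h v).entries ↔
      ∃ i : Fin dbar, (sortedElements h)[(i : ℕ)]? = some a ∧ v i = r ∧ τ + T < r := by
  simp only [release, Finset.mem_biUnion, Finset.mem_univ, true_and]
  refine exists_congr fun i => ?_
  cases hi : (sortedElements h)[(i : ℕ)]? with
  | none => simp only [Finset.notMem_empty, reduceCtorEq, false_and]
  | some b =>
    dsimp only
    split_ifs with hv
    · simp only [Finset.mem_singleton, Prod.mk.injEq, Option.some.injEq]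
      constructor
      · rintro ⟨rfl, rfl⟩
        exact ⟨rfl, rfl, hv⟩
      · rintro ⟨rfl, rfl, -⟩
        exact ⟨rfl, rfl⟩
    · simp only [Finset.notMem_empty, false_iff]
      rintro ⟨-, rfl, hr⟩
      exact hv hr

theorem release_eq_releaseOn {dbar : ℕ} {τ T : ℝ} (hτ : 0 ≤ τ) {e : commonElements h k → Fin dbar}
    (he : ∀ a : commonElements h k, (sortedElements h)[(e a : ℕ)]? = some (a : U))
    {v : Fin dbar → ℝ} (hv : v ∈ commonEvent dbar T h k) :
    release dbar τ T h v = releaseOn (commonElements h k) (τ + T) fun a => v (e a) := by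
  ext ⟨a, r⟩
  rw [mem_release, mem_releaseOn]
  constructor
  · rintro ⟨i, hi, rfl, hr⟩
    have hka : k a ≠ 0 := by
      intro hka
      have hle : v i ≤ rankedCount h k i + T := (hv i trivial).2.2
      rw [rankedCount_of_some hi, hka, Nat.cast_zero] at hle
      linarith
    have ha : a ∈ commonElements h k :=
      mem_commonElements.mpr ⟨ne_zero_of_getElem?_sortedElements hi, hka⟩
    exact ⟨ha, congrArg v (Fin.ext (getElem?_sortedElements_inj (he ⟨a, ha⟩) hi)), hr⟩
  · rintro ⟨ha, rfl, hr⟩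
    exact ⟨e ⟨a, ha⟩, he ⟨a, ha⟩, rfl, hr⟩

section Mechanism

variable {dbar Δ : ℕ} {τ σ T : ℝ} (hτ : 0 < τ) (hσ : 0 < σ) (hT : 0 < T)

theorem map_cond_commonEvent_prob_mechanism (hhk : ∀ a, |(h a : ℝ) - k a| ≤ τ) (hτT : τ < 2 * T)
    {κ : Type*} [Fintype κ] {e : κ → Fin dbar} (he : Function.Injective e) :
    (((mechanism U dbar hτ hσ hT).prob h)[|commonEvent dbar T h k]).map (fun v a => v (e a)) =
      Measure.pi fun a => (gaussianReal (sortedCount h (e a)) (.mk ((τ * σ) ^ 2) (sq_nonneg _)))[|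
        commonWindow T (sortedCount h (e a)) (rankedCount h k (e a))] := by
  have hs : 0 < τ * σ := mul_pos hτ hσ
  have htrunc (i : Fin dbar) := isProbabilityMeasure_truncNormal hT hs (sortedCount h i)
  have hcond (i : Fin dbar) : IsProbabilityMeasure ((truncNormal T (sortedCount h i) (τ * σ))[|
      commonWindow T (sortedCount h i) (rankedCount h k i)]) :=
    cond_isProbabilityMeasure (truncNormal_commonWindow_ne_zero hT hs
      ((abs_sortedCount_sub_rankedCount_le hτ.le hhk i).trans_lt hτT))
  simp_rw [← cond_truncNormal_commonWindow hT hs]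
  exact (congrArg (Measure.map _) (cond_pi _ fun _ => measurableSet_commonWindow _ _ _)).trans
    (map_pi_precomp _ he)

theorem condLaw_mechanism_commonEvent (hhk : ∀ a, |(h a : ℝ) - k a| ≤ τ)
    (hd : h.support.card ≤ dbar) (hτT : τ < 2 * T) :
    (mechanism U dbar hτ hσ hT).condLaw h (commonEvent dbar T h k) =
      (Measure.pi fun a : commonElements h k =>
        (gaussianReal (h a) (.mk ((τ * σ) ^ 2) (sq_nonneg _)))[|commonWindow T (h a) (k a)]).map
          (releaseOn (commonElements h k) (τ + T)) := by
  choose e he using fun a : commonElements h k =>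
    exists_getElem?_sortedElements hd (mem_commonElements.mp a.2).1
  have hinj : Function.Injective e := fun a b hab =>
    Subtype.ext (Option.some.inj ((he a).symm.trans (hab ▸ he b)))
  have hrelease : release dbar τ T h
      =ᵐ[((mechanism U dbar hτ hσ hT).prob h)[|commonEvent dbar T h k]]
        releaseOn (commonElements h k) (τ + T) ∘ fun v a => v (e a) := by
    filter_upwards [ae_cond_mem (measurableSet_commonEvent dbar T h k)] with v hv
    exact release_eq_releaseOn hτ.le he hv
  rw [RandomizedAlgorithm.condLaw,
    show (mechanism U dbar hτ hσ hT).out h = release dbar τ T h from rfl,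
    Measure.map_congr hrelease, ← Measure.map_map (measurable_releaseOn _ _) (by fun_prop),
    map_cond_commonEvent_prob_mechanism hτ hσ hT hhk hτT hinj]
  simp_rw [sortedCount_of_some (he _), rankedCount_of_some (he _)]

theorem prob_commonEvent (hhk : ∀ a, |(h a : ℝ) - k a| ≤ τ) (hτT : τ ≤ 2 * T) :
    (mechanism U dbar hτ hσ hT).prob h (commonEvent dbar T h k) =
      ∏ i : Fin dbar, ENNReal.ofReal
        (overlapProb T (τ * σ) |(sortedCount h i : ℝ) - rankedCount h k i|) := by
  have hs : 0 < τ * σ := mul_pos hτ hσ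
  have htrunc (i : Fin dbar) := isProbabilityMeasure_truncNormal hT hs (sortedCount h i)
  rw [mechanism, commonEvent, Measure.pi_pi]
  exact Finset.prod_congr rfl fun i _ => truncNormal_commonWindow hT hs
    ((abs_sortedCount_sub_rankedCount_le hτ.le hhk i).trans hτT)

theorem ofReal_overlapProb_pow_le_prob_commonEvent (hhk : ∀ a, |(h a : ℝ) - k a| ≤ τ)
    (hΔ : {a | h a ≠ k a}.ncard ≤ Δ) (hτT : τ ≤ 2 * T) :
    ENNReal.ofReal (overlapProb T (τ * σ) τ) ^ Δ ≤
      (mechanism U dbar hτ hσ hT).prob h (commonEvent dbar T h k) := by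
  have hs : 0 < τ * σ := mul_pos hτ hσ
  have hle_one : ENNReal.ofReal (overlapProb T (τ * σ) τ) ≤ 1 := by
    rw [ENNReal.ofReal_le_one, ← overlapProb_zero hT hs]
    exact antitone_overlapProb hT hs hτ.le
  refine (pow_le_pow_right_of_le_one' hle_one
    ((card_sortedCount_ne_rankedCount_le dbar h k).trans hΔ)).trans ?_
  rw [prob_commonEvent hτ hσ hT hhk hτT, ← Finset.prod_const, Finset.prod_filter]
  refine Finset.prod_le_prod' fun i _ => ?_
  split_ifs with hne
  · exact ENNReal.ofReal_le_ofReal (antitone_overlapProb hT hs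
      (abs_sortedCount_sub_rankedCount_le hτ.le hhk i))
  · rw [not_not.mp hne, sub_self, abs_zero, overlapProb_zero hT hs, ENNReal.ofReal_one]

theorem isTruncationLevel_iff {δ : ℝ} :
    IsTruncationLevel Δ τ σ δ T ↔ δ = Δ * (1 - overlapProb T (τ * σ) τ) :=
  Iff.rfl

theorem IsTruncationLevel.overlapProb_pos {δ : ℝ} (hlevel : IsTruncationLevel Δ τ σ δ T)
    (hδ : δ < Δ) : 0 < overlapProb T (τ * σ) τ := by
  have hpos : 0 < (Δ : ℝ) * overlapProb T (τ * σ) τ := by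
    linarith [isTruncationLevel_iff.mp hlevel]
  exact pos_of_mul_pos_right hpos Δ.cast_nonneg

theorem IsTruncationLevel.ofReal_one_sub_le {δ : ℝ} (hlevel : IsTruncationLevel Δ τ σ δ T)
    (hδ : δ < Δ) : ENNReal.ofReal (1 - δ) ≤ ENNReal.ofReal (overlapProb T (τ * σ) τ) ^ Δ := by
  have hpos := hlevel.overlapProb_pos hδ
  rw [← ENNReal.ofReal_pow hpos.le]
  refine ENNReal.ofReal_le_ofReal ?_
  calc 1 - δ = 1 + Δ * (overlapProb T (τ * σ) τ - 1) := by
        rw [isTruncationLevel_iff.mp hlevel]; ring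
    _ ≤ (1 + (overlapProb T (τ * σ) τ - 1)) ^ Δ := one_add_mul_le_pow (by linarith) Δ
    _ = overlapProb T (τ * σ) τ ^ Δ := by rw [add_sub_cancel]

theorem sum_sq_sub_le (hhk : ∀ a, |(h a : ℝ) - k a| ≤ τ) (hΔ : {a | h a ≠ k a}.ncard ≤ Δ)
    (K : Finset U) : ∑ a ∈ K, ((h a : ℝ) - k a) ^ 2 ≤ Δ * τ ^ 2 := by
  have hcard : (K.filter fun a => h a ≠ k a).card ≤ Δ := by
    rw [← Set.ncard_coe_finset]
    exact (Set.ncard_le_ncard (fun a ha => (Finset.mem_filter.mp ha).2)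
      (finite_setOf_ne h k)).trans hΔ
  calc ∑ a ∈ K, ((h a : ℝ) - k a) ^ 2
      = ∑ a ∈ K with h a ≠ k a, ((h a : ℝ) - k a) ^ 2 := by
        refine (Finset.sum_filter_of_ne (p := fun a => h a ≠ k a) fun a _ hsq heq => hsq ?_).symm
        rw [heq, sub_self, zero_pow two_ne_zero]
    _ ≤ (K.filter fun a => h a ≠ k a).card • τ ^ 2 :=
        Finset.sum_le_card_nsmul _ _ _ fun a _ => sq_le_sq' (abs_le.mp (hhk a)).1
          (abs_le.mp (hhk a)).2
    _ ≤ Δ * τ ^ 2 := by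
        rw [nsmul_eq_mul]
        gcongr

/-- Histograms `h` and `k` that can arise from neighbouring datasets: both have at most `dbar`
nonzero counts, and they differ in at most `Δ` counts, each by at most `τ`. -/
structure AreNeighbors (dbar Δ : ℕ) (τ : ℝ) (h k : U →₀ ℕ) : Prop where
  card_support_left : h.support.card ≤ dbar
  card_support_right : k.support.card ≤ dbar
  ncard_ne_le : {a | h a ≠ k a}.ncard ≤ Δ
  abs_sub_le : ∀ a, |(h a : ℝ) - k a| ≤ τ

theorem AreNeighbors.symm (hhk : AreNeighbors dbar Δ τ h k) : AreNeighbors dbar Δ τ k h where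
  card_support_left := hhk.card_support_right
  card_support_right := hhk.card_support_left
  ncard_ne_le := by simpa only [ne_comm] using hhk.ncard_ne_le
  abs_sub_le a := abs_sub_comm (h a : ℝ) (k a) ▸ hhk.abs_sub_le a

theorem renyiDiv_condLaw_mechanism_le (hhk : AreNeighbors dbar Δ τ h k) (hτT : τ < 2 * T) {α : ℝ}
    (hα : 1 < α) :
    renyiDiv α ((mechanism U dbar hτ hσ hT).condLaw h (commonEvent dbar T h k))
      ((mechanism U dbar hτ hσ hT).condLaw k (commonEvent dbar T k h)) ≤
      ((α * (Δ / (2 * σ ^ 2)) : ℝ) : EReal) := by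
  have hs : 0 < τ * σ := mul_pos hτ hσ
  have hprob (a : U) := cond_isProbabilityMeasure (gaussianReal_commonWindow_ne_zero hs
    ((hhk.abs_sub_le a).trans_lt hτT))
  have hprob' (a : U) := cond_isProbabilityMeasure (gaussianReal_commonWindow_ne_zero hs
    ((hhk.symm.abs_sub_le a).trans_lt hτT))
  rw [condLaw_mechanism_commonEvent hτ hσ hT hhk.abs_sub_le hhk.card_support_left hτT,
    condLaw_mechanism_commonEvent hτ hσ hT hhk.symm.abs_sub_le hhk.card_support_right hτT,
    commonElements_comm k h]
  simp_rw [commonWindow_comm T (k _)] at hprob' ⊢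
  refine (renyiDiv_map_le (measurable_releaseOn _ _) hα).trans ((renyiDiv_pi_le _ _ hα fun a =>
    renyiDiv_cond_gaussianReal_commonWindow_le (mk_sq_ne_zero hs.ne') T _ _ hα).trans ?_)
  rw [EReal.coe_le_coe_iff, NNReal.coe_mk, Finset.sum_coe_sort (commonElements h k)
    fun a => α * (((h a : ℝ) - k a) ^ 2 / (2 * (τ * σ) ^ 2)), ← Finset.mul_sum, ← Finset.sum_div]
  refine mul_le_mul_of_nonneg_left ?_ (zero_le_one.trans hα.le)
  calc (∑ a ∈ commonElements h k, ((h a : ℝ) - k a) ^ 2) / (2 * (τ * σ) ^ 2)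
      ≤ Δ * τ ^ 2 / (2 * (τ * σ) ^ 2) := by
        gcongr
        exact sum_sq_sub_le hhk.abs_sub_le hhk.ncard_ne_le _
    _ = Δ / (2 * σ ^ 2) := by field_simp

end Mechanism

end TruncGauss

namespace RandomizedAlgorithm

variable {X Ω Y : Type*} [MeasurableSpace Ω] [MeasurableSpace Y] {M : RandomizedAlgorithm X Ω Y}
  {nbr : X → X → Prop} {δ ξ ρ : ℝ}

theorem IsApproxZCDP.comp (hM : M.IsApproxZCDP nbr δ ξ ρ) {X' : Type*} {nbr' : X' → X' → Prop}
    {f : X' → X} (hf : ∀ x x', nbr' x x' → nbr (f x) (f x')) :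
    (M.comp f).IsApproxZCDP nbr' δ ξ ρ := fun x x' hx => hM (f x) (f x') (hf x x' hx)

theorem isApproxZCDP_of_symm (hsymm : ∀ {x x'}, nbr x x' → nbr x' x) (E : X → X → Set Ω)
    (hE : ∀ x x', MeasurableSet (E x x')) (hpos : ∀ x x', nbr x x' → M.prob x (E x x') ≠ 0)
    (hprob : ∀ x x', nbr x x' → ENNReal.ofReal (1 - δ) ≤ M.prob x (E x x'))
    (hdiv : ∀ x x', nbr x x' → ∀ α : ℝ, 1 < α →
      renyiDiv α (M.condLaw x (E x x')) (M.condLaw x' (E x' x)) ≤ ((α * ρ + ξ : ℝ) : EReal)) :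
    M.IsApproxZCDP nbr δ ξ ρ := fun x x' hx =>
  ⟨E x x', E x' x, hE x x', hE x' x, hpos x x' hx, hpos x' x (hsymm hx), hprob x x' hx,
    hprob x' x (hsymm hx), fun α hα => ⟨hdiv x x' hx α hα, hdiv x' x (hsymm hx) α hα⟩⟩

end RandomizedAlgorithm

theorem TruncGauss.isApproxZCDP_mechanism {U : Type*} {dbar Δ : ℕ} {τ σ δ T : ℝ} (hτ : 0 < τ)
    (hσ : 0 < σ) (hT : 0 < T) (hδ : δ < Δ) (hlevel : IsTruncationLevel Δ τ σ δ T) :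
    (mechanism U dbar hτ hσ hT).IsApproxZCDP (AreNeighbors dbar Δ τ) δ 0 (Δ / (2 * σ ^ 2)) := by
  have hoverlap := hlevel.overlapProb_pos hδ
  have hτT : τ < 2 * T := (overlapProb_pos_iff hT (mul_pos hτ hσ)).mp hoverlap
  have hmass (h k : U →₀ ℕ) (hhk : AreNeighbors dbar Δ τ h k) :=
    ofReal_overlapProb_pow_le_prob_commonEvent (dbar := dbar) hτ hσ hT hhk.abs_sub_le
      hhk.ncard_ne_le hτT.le
  refine RandomizedAlgorithm.isApproxZCDP_of_symm AreNeighbors.symm (commonEvent dbar T)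
    (measurableSet_commonEvent dbar T) (fun h k hhk => ?_)
    (fun h k hhk => (hlevel.ofReal_one_sub_le hδ).trans (hmass h k hhk)) fun h k hhk α hα => ?_
  · exact ((ENNReal.pow_pos (ENNReal.ofReal_pos.mpr hoverlap) Δ).trans_le (hmass h k hhk)).ne'
  · rw [add_zero]
    exact renyiDiv_condLaw_mechanism_le hτ hσ hT hhk hτT hα

theorem mainTheorem8 {X U : Type*} (nbr : X → X → Prop) (hist : X → U →₀ ℕ)
    (Δ dbar : ℕ) (τ σ δ T : ℝ) (hτ : 0 < τ) (hσ : 0 < σ) (hT : 0 < T) (hδ : δ < Δ)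
    (hdbar : ∀ x, (hist x).support.card ≤ dbar)
    (hL0 : HasL0Sensitivity nbr hist Δ) (hLInfty : HasLInftySensitivity nbr hist τ)
    (hlevel : TruncGauss.IsTruncationLevel Δ τ σ δ T) :
    ((TruncGauss.mechanism U dbar hτ hσ hT).comp hist).IsApproxZCDP nbr δ 0
      (Δ / (2 * σ ^ 2)) := by
  refine (TruncGauss.isApproxZCDP_mechanism hτ hσ hT hδ hlevel).comp fun x x' hx => ?_
  exact ⟨hdbar x, hdbar x', hL0 x x' hx, hLInfty x x' hx⟩
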